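/- Let $\mathbb{H}=\{\tau\in\mathbb{C}\mid \mathrm{Im}\,\tau>0\}$. The Siegel–Jacobi space $\mathbb{S}^J$ is the complex manifold $\mathbb{H}\times\mathbb{C}$, with coordinates $\tau=u+iv$, $z=x+iy$, the Kähler–Berndt metric $$g_{KB}=\tfrac12\Big(\tfrac{v+y^2}{v^3}(du^2+dv^2)-\tfrac{2y}{v^2}(du\,dx+dv\,dy)+\tfrac1v(dx^2+dy^2)\Big),$$ and the Kähler–Berndt symplectic form $\omega_{KB}(a,b)=g_{KB}(ia,b)$. Let $\Omega(X,Y)=X_1Y_2-X_2Y_1$ on $\mathbb{R}^2$ (row vectors). The Jacobi group $G^J(\mathbb{R})$ is $\mathrm{SL}(2,\mathbb{R})\times\mathbb{R}^2\times\mathbb{R}$ with the product $$(M_1,X_1,\kappa_1)(M_2,X_2,\kappa_2)=(M_1M_2,\;X_1M_2+X_2,\;\kappa_1+\kappa_2+\Omega(X_1M_2,X_2)).$$ It acts on $\mathbb{S}^J$ by $$\Big(\begin{bmatrix}a&b\\c&d\end{bmatrix},(\lambda,\mu),\kappa\Big)\cdot(\tau,z)=\Big(\tfrac{a\tau+b}{c\tau+d},\tfrac{z+\lambda\tau+\mu}{c\tau+d}\Big).$$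 Its Lie algebra $\mathfrak{g}^J$ is $\mathfrak{sl}(2,\mathbb{R})\times\mathbb{R}^2\times\mathbb{R}$ with the bracket $$[(A,\xi,r),(B,\eta,s)]=([A,B],\;\xi B-\eta A,\;2\Omega(\xi,\eta)).$$ Let $F=\begin{bmatrix}0&1\\0&0\end{bmatrix}$, $G=\begin{bmatrix}0&0\\1&0\end{bmatrix}$, $H=\begin{bmatrix}1&0\\0&-1\end{bmatrix}$ in $\mathfrak{sl}(2,\mathbb{R})$ and let $P,Q,R$ be the canonical basis of $\mathbb{R}^2\times\mathbb{R}$; together they form a basis of $\mathfrak{g}^J$. Put $\theta_1=y$, $\theta_2=-v$, $\dot\theta_1=-x$, $\dot\theta_2=u$, $\eta_1=-\frac{\theta_1}{2\theta_2}$ and $\eta_2=\frac{\theta_1^2-2\theta_2}{4\theta_2^2}$. Let $\mathbf{J}:\mathbb{S}^J\to(\mathfrak{g}^J)^*$ be the map $\mathbf{J}(p)(L)=\psi(L)(p)$, where $\psi:\mathfrak{g}^J\to C^\infty(\mathbb{S}^J)$ is the linear map with $$\psi(F)=-\eta_2,\qquad \psi(G)=\tfrac14\dot\theta_1^2+\eta_2\dot\theta_2^2+\eta_1\dot\theta_1\dot\theta_2-\tfrac{1}{4(\eta_1^2-\eta_2)},\qquad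 \psi(H)=-\eta_1\dot\theta_1-2\eta_2\dot\theta_2,$$ $$\psi(P)=\tfrac12\dot\theta_1+\eta_1\dot\theta_2,\qquad \psi(Q)=\eta_1,\qquad \psi(R)=-\tfrac14 .$$ For $\alpha\in(\mathfrak{g}^J)^*$ put $\langle\mathrm{Ad}^*(g)\alpha,L\rangle=\langle\alpha,\mathrm{Ad}(g^{-1})L\rangle$ and $\langle\mathrm{ad}^*(L)\alpha,K\rangle=\langle\alpha,[L,K]\rangle$. A coadjoint orbit $\mathcal{O}=\{\mathrm{Ad}^*(g)\mu\mid g\in G^J(\mathbb{R})\}$ is an immersed submanifold of $(\mathfrak{g}^J)^*$ with tangent spaces $T_\alpha\mathcal{O}=\{\mathrm{ad}^*(L)\alpha\mid L\in\mathfrak{g}^J\}$, and its Kirillov–Kostant–Souriau form is $(\omega_{\mathcal{O}})_\alpha(\mathrm{ad}^*(L)\alpha,\mathrm{ad}^*(K)\alpha)=\langle\alpha,[L,K]\rangle$. **Proposition.** The map $\mathbf{J}$ is a momentum map for the action of $G^J(\mathbb{R})$ on $(\mathbb{S}^J,\omega_{KB})$: it is smooth and, for every $L\in\mathfrak{g}^J$,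 the fundamental vector field of $L$ is the Hamiltonian vector field $X_f$ (defined by $\omega_{KB}(X_f,\cdot)=df$) of the function $f=\mathbf{J}(\cdot)(L)$. Moreover, the image of $\mathbf{J}$ is a coadjoint orbit $\mathcal{O}$ of $G^J(\mathbb{R})$, which is an embedded submanifold of $(\mathfrak{g}^J)^*$; $\mathbf{J}:\mathbb{S}^J\to\mathcal{O}$ is a diffeomorphism; and $\mathbf{J}^*\omega_{\mathcal{O}}=\omega_{KB}$. Thus $\mathbb{S}^J$, as a symplectic manifold, is a coadjoint orbit of the Jacobi group. -/

import Mathlib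

open scoped Manifold ContDiff Matrix MatrixGroups UpperHalfPlane

noncomputable section

namespace SiegelJacobi

/-! ### The Jacobi group -/

/-- The standard symplectic form on `ℝ²`: `Ω(X, Y) = X₁ Y₂ - X₂ Y₁`. -/
def Om (X Y : Fin 2 → ℝ) : ℝ := X 0 * Y 1 - X 1 * Y 0

/-- The Jacobi group `SL(2, ℝ) ⋉ Heis(ℝ)`: triples `(M, X, κ)`, with `X ∈ ℝ²` a row vector. -/
@[ext]
structure JacobiGroup where
  M : SL(2, ℝ)
  X : Fin 2 → ℝ
  κ : ℝ

namespace JacobiGroup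

instance : Mul JacobiGroup :=
  ⟨fun g h => ⟨g.M * h.M, g.X ᵥ* h.M.1 + h.X, g.κ + h.κ + Om (g.X ᵥ* h.M.1) h.X⟩⟩

instance : One JacobiGroup := ⟨⟨1, 0, 0⟩⟩

instance : Inv JacobiGroup := ⟨fun g => ⟨g.M⁻¹, -(g.X ᵥ* (g.M⁻¹).1), -g.κ⟩⟩

theorem mul_M (g h : JacobiGroup) : (g * h).M = g.M * h.M := rfl
theorem mul_X (g h : JacobiGroup) : (g * h).X = g.X ᵥ* h.M.1 + h.X := rfl
theorem mul_κ (g h : JacobiGroup) :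
    (g * h).κ = g.κ + h.κ + Om (g.X ᵥ* h.M.1) h.X := rfl
theorem one_M : (1 : JacobiGroup).M = 1 := rfl
theorem one_X : (1 : JacobiGroup).X = 0 := rfl
theorem one_κ : (1 : JacobiGroup).κ = 0 := rfl
theorem inv_M (g : JacobiGroup) : (g⁻¹).M = g.M⁻¹ := rfl
theorem inv_X (g : JacobiGroup) : (g⁻¹).X = -(g.X ᵥ* (g.M⁻¹).1) := rfl
theorem inv_κ (g : JacobiGroup) : (g⁻¹).κ = -g.κ := rfl

theorem det_eq (M : SL(2, ℝ)) : M.1 0 0 * M.1 1 1 - M.1 0 1 * M.1 1 0 = 1 := by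
  rw [← Matrix.det_fin_two]; exact M.2

theorem Om_vecMul (M : SL(2, ℝ)) (X Y : Fin 2 → ℝ) :
    Om (X ᵥ* M.1) (Y ᵥ* M.1) = Om X Y := by
  have h := det_eq M
  simp only [Om, Matrix.vecMul, dotProduct, Fin.sum_univ_two]
  linear_combination (X 0 * Y 1 - X 1 * Y 0) * h

instance : Group JacobiGroup := Group.ofLeftAxioms
  (by
    intro a b c
    ext i
    · simp only [mul_M, mul_assoc]
    · simp only [mul_X, mul_M, Matrix.SpecialLinearGroup.coe_mul, Matrix.add_vecMul,
        Matrix.vecMul_vecMul, add_assoc]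
    · simp only [mul_κ, mul_X, mul_M, Matrix.add_vecMul, Matrix.SpecialLinearGroup.coe_mul,
        ← Matrix.vecMul_vecMul]
      have h := Om_vecMul c.M (a.X ᵥ* b.M.1) b.X
      simp only [Om, Pi.add_apply] at h ⊢
      linarith)
  (by
    intro a
    ext i
    · simp only [mul_M, one_M, one_mul]
    · simp [mul_X, one_X]
    · simp [mul_κ, one_κ, one_X, Om])
  (by
    intro a
    have h : (a.X ᵥ* (a.M⁻¹).1) ᵥ* a.M.1 = a.X := by
      rw [Matrix.vecMul_vecMul, ← Matrix.SpecialLinearGroup.coe_mul, inv_mul_cancel]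
      simp
    ext i
    · simp [mul_M, inv_M, one_M]
    · simp only [mul_X, inv_X, one_X, Matrix.neg_vecMul, h, neg_add_cancel]
    · simp only [mul_κ, inv_κ, one_κ, inv_X, Matrix.neg_vecMul, h, Om, Pi.neg_apply]
      ring)

theorem denom_ne_zero (M : SL(2, ℝ)) (τ : ℍ) :
    ((M.1 1 0 : ℝ) : ℂ) * (τ : ℂ) + ((M.1 1 1 : ℝ) : ℂ) ≠ 0 :=
  UpperHalfPlane.denom_ne_zero (M : GL (Fin 2) ℝ) τ

/-- The left action of the Jacobi group on `ℍ × ℂ`: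
`(M, (lam, mu), κ) • (τ, z) = ((aτ + b)/(cτ + d), (z + lam τ + mu)/(cτ + d))`. -/
instance : SMul JacobiGroup (ℍ × ℂ) :=
  ⟨fun g p => (g.M • p.1, (p.2 + g.X 0 * (p.1 : ℂ) + g.X 1) /
    (((g.M.1 1 0 : ℝ) : ℂ) * (p.1 : ℂ) + ((g.M.1 1 1 : ℝ) : ℂ)))⟩

theorem smul_fst (g : JacobiGroup) (p : ℍ × ℂ) : (g • p).1 = g.M • p.1 := rfl

theorem coe_smul_fst (g : JacobiGroup) (p : ℍ × ℂ) : ((g • p).1 : ℂ) =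
    (((g.M.1 0 0 : ℝ) : ℂ) * (p.1 : ℂ) + ((g.M.1 0 1 : ℝ) : ℂ)) /
    (((g.M.1 1 0 : ℝ) : ℂ) * (p.1 : ℂ) + ((g.M.1 1 1 : ℝ) : ℂ)) :=
  UpperHalfPlane.coe_specialLinearGroup_apply g.M p.1

theorem smul_snd (g : JacobiGroup) (p : ℍ × ℂ) : (g • p).2 =
    (p.2 + g.X 0 * (p.1 : ℂ) + g.X 1) /
    (((g.M.1 1 0 : ℝ) : ℂ) * (p.1 : ℂ) + ((g.M.1 1 1 : ℝ) : ℂ)) := rfl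

instance : MulAction JacobiGroup (ℍ × ℂ) where
  one_smul p := by
    refine Prod.ext ?_ ?_
    · rw [smul_fst, one_M, one_smul]
    · simp [smul_snd, one_M, one_X]
  mul_smul g h p := by
    refine Prod.ext ?_ ?_
    · simp only [smul_fst, mul_M, mul_smul]
    · have h1 := denom_ne_zero h.M p.1
      have h2 := denom_ne_zero (g.M * h.M) p.1
      have h3 := denom_ne_zero g.M (h.M • p.1)
      rw [smul_snd, smul_snd g, smul_snd h, coe_smul_fst h]
      rw [show (((h.M • p.1 : ℍ)) : ℂ) = _ from coe_smul_fst h p] at h3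
      simp only [mul_M, mul_X, Matrix.SpecialLinearGroup.coe_mul, Matrix.mul_apply,
        Fin.sum_univ_two, Pi.add_apply, Matrix.vecMul, dotProduct] at h2 ⊢
      rw [div_eq_div_iff h2 h3]
      push_cast
      field_simp
      ring

end JacobiGroup

/-! ### The Lie algebra of the Jacobi group -/

/-- The Lie algebra `sl(2, ℝ) ⋉ heis` of the Jacobi group: triples `(A, ξ, r)`. -/
def JacobiAlgebra : Type :=
  LieAlgebra.SpecialLinear.sl (Fin 2) ℝ × (Fin 2 → ℝ) × ℝ

namespace JacobiAlgebra

instance : AddCommGroup JacobiAlgebra :=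
  inferInstanceAs (AddCommGroup (LieAlgebra.SpecialLinear.sl (Fin 2) ℝ × (Fin 2 → ℝ) × ℝ))

instance : Module ℝ JacobiAlgebra :=
  inferInstanceAs (Module ℝ (LieAlgebra.SpecialLinear.sl (Fin 2) ℝ × (Fin 2 → ℝ) × ℝ))

instance : FiniteDimensional ℝ JacobiAlgebra :=
  inferInstanceAs (FiniteDimensional ℝ
    (LieAlgebra.SpecialLinear.sl (Fin 2) ℝ × (Fin 2 → ℝ) × ℝ))

/-- The matrix component. -/
def A (x : JacobiAlgebra) : Matrix (Fin 2) (Fin 2) ℝ := x.1.1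

/-- The `ℝ²` component. -/
def ξ (x : JacobiAlgebra) : Fin 2 → ℝ := x.2.1

/-- The central component. -/
def r (x : JacobiAlgebra) : ℝ := x.2.2

theorem trace_A (x : JacobiAlgebra) : x.A.trace = 0 := x.1.2

/-- The element `(A, ξ, r)`. -/
def mk (A : Matrix (Fin 2) (Fin 2) ℝ) (hA : A.trace = 0) (ξ : Fin 2 → ℝ) (r : ℝ) :
    JacobiAlgebra := (⟨A, hA⟩, ξ, r)

@[ext]
theorem ext {x y : JacobiAlgebra} (h1 : x.A = y.A) (h2 : x.ξ = y.ξ) (h3 : x.r = y.r) : x = y :=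
  Prod.ext (Subtype.ext h1) (Prod.ext h2 h3)

@[simp] theorem A_mk (A : Matrix (Fin 2) (Fin 2) ℝ) (hA) (ξ : Fin 2 → ℝ) (r : ℝ) :
    (mk A hA ξ r).A = A := rfl
@[simp] theorem ξ_mk (A : Matrix (Fin 2) (Fin 2) ℝ) (hA) (ξ : Fin 2 → ℝ) (r : ℝ) :
    (mk A hA ξ r).ξ = ξ := rfl
@[simp] theorem r_mk (A : Matrix (Fin 2) (Fin 2) ℝ) (hA) (ξ : Fin 2 → ℝ) (r : ℝ) :
    (mk A hA ξ r).r = r := rfl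
@[simp] theorem A_add (x y : JacobiAlgebra) : (x + y).A = x.A + y.A := rfl
@[simp] theorem ξ_add (x y : JacobiAlgebra) : (x + y).ξ = x.ξ + y.ξ := rfl
@[simp] theorem r_add (x y : JacobiAlgebra) : (x + y).r = x.r + y.r := rfl
@[simp] theorem A_smul (c : ℝ) (x : JacobiAlgebra) : (c • x).A = c • x.A := rfl
@[simp] theorem ξ_smul (c : ℝ) (x : JacobiAlgebra) : (c • x).ξ = c • x.ξ := rfl
@[simp] theorem r_smul (c : ℝ) (x : JacobiAlgebra) : (c • x).r = c * x.r := rfl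
@[simp] theorem A_zero : (0 : JacobiAlgebra).A = 0 := rfl
@[simp] theorem ξ_zero : (0 : JacobiAlgebra).ξ = 0 := rfl
@[simp] theorem r_zero : (0 : JacobiAlgebra).r = 0 := rfl

/-- The bracket `[(A, ξ, r), (B, η, s)] = ([A, B], ξ B - η A, 2 Ω(ξ, η))`. -/
instance : Bracket JacobiAlgebra JacobiAlgebra :=
  ⟨fun x y => mk (x.A * y.A - y.A * x.A)
    (by rw [Matrix.trace_sub, Matrix.trace_mul_comm, sub_self])
    (x.ξ ᵥ* y.A - y.ξ ᵥ* x.A) (2 * Om x.ξ y.ξ)⟩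

theorem A_lie (x y : JacobiAlgebra) : ⁅x, y⁆.A = x.A * y.A - y.A * x.A := rfl
theorem ξ_lie (x y : JacobiAlgebra) : ⁅x, y⁆.ξ = x.ξ ᵥ* y.A - y.ξ ᵥ* x.A := rfl
theorem r_lie (x y : JacobiAlgebra) : ⁅x, y⁆.r = 2 * Om x.ξ y.ξ := rfl

instance : LieRing JacobiAlgebra where
  add_lie x y z := by
    refine JacobiAlgebra.ext ?_ ?_ ?_
    · simp only [A_lie, A_add]; noncomm_ring
    · simp only [ξ_lie, ξ_add, A_add, Matrix.add_vecMul, Matrix.vecMul_add]; abel_nf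
    · simp only [r_lie, r_add, ξ_add, Om, Pi.add_apply]; ring
  lie_add x y z := by
    refine JacobiAlgebra.ext ?_ ?_ ?_
    · simp only [A_lie, A_add]; noncomm_ring
    · simp only [ξ_lie, ξ_add, A_add, Matrix.add_vecMul, Matrix.vecMul_add]; abel_nf
    · simp only [r_lie, r_add, ξ_add, Om, Pi.add_apply]; ring
  lie_self x := by
    refine JacobiAlgebra.ext ?_ ?_ ?_
    · simp [A_lie]
    · simp [ξ_lie]
    · simp only [r_lie, Om, r_zero]; ring
  leibniz_lie x y z := by
    have hx := x.trace_A
    have hy := y.trace_A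
    have hz := z.trace_A
    simp only [Matrix.trace_fin_two] at hx hy hz
    refine JacobiAlgebra.ext ?_ ?_ ?_
    · simp only [A_lie, A_add]; noncomm_ring
    · simp only [ξ_lie, ξ_add, A_lie, Matrix.sub_vecMul, Matrix.vecMul_sub,
        Matrix.vecMul_vecMul]; abel_nf
    · simp only [r_lie, r_add, ξ_lie, Om, Pi.sub_apply, Matrix.vecMul, dotProduct,
        Fin.sum_univ_two]
      linear_combination 2 * (x.ξ 0 * y.ξ 1 - x.ξ 1 * y.ξ 0) * hz
        - 2 * (x.ξ 0 * z.ξ 1 - x.ξ 1 * z.ξ 0) * hy + 2 * (y.ξ 0 * z.ξ 1 - y.ξ 1 * z.ξ 0) * hx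

instance : LieAlgebra ℝ JacobiAlgebra where
  lie_smul c x y := by
    refine JacobiAlgebra.ext ?_ ?_ ?_
    · simp [A_lie, smul_sub]
    · simp [ξ_lie, Matrix.vecMul_smul, Matrix.smul_vecMul, smul_sub]
    · simp only [r_lie, r_smul, ξ_smul, Om, Pi.smul_apply, smul_eq_mul]; ring

/-- The coordinates of `(A, ξ, r)`, as a linear map into a normed space. -/
def coords : JacobiAlgebra →ₗ[ℝ] (Fin 2 → Fin 2 → ℝ) × (Fin 2 → ℝ) × ℝ where
  toFun x := (fun i j => x.A i j, x.ξ, x.r)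
  map_add' _ _ := rfl
  map_smul' _ _ := rfl

theorem coords_injective : Function.Injective coords := by
  intro x y h
  have h1 : x.A = y.A := congrArg Prod.fst h
  have h2 : x.ξ = y.ξ := congrArg (fun q => q.2.1) h
  have h3 : x.r = y.r := congrArg (fun q => q.2.2) h
  exact ext h1 h2 h3

/-- A norm on the (finite dimensional) Lie algebra. It only serves to give the Lie algebra and
its dual their canonical vector space topology and smooth structure. -/
instance : NormedAddCommGroup JacobiAlgebra :=
  NormedAddCommGroup.induced JacobiAlgebra _ coords coords_injective

instance : NormedSpace ℝ JacobiAlgebra :=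
  NormedSpace.induced ℝ JacobiAlgebra _ coords

end JacobiAlgebra

/-- The dual of the Lie algebra (every linear functional is continuous). -/
abbrev JacobiDual : Type := JacobiAlgebra →L[ℝ] ℝ

/-- The curve `γ` in the Jacobi group passes through the identity at time `0` with velocity `x`
in the Lie algebra (derivative taken entrywise). -/
structure HasVelocityAtOne (γ : ℝ → JacobiGroup) (x : JacobiAlgebra) : Prop where
  zero : γ 0 = 1
  M : ∀ i j, HasDerivAt (fun t => (γ t).M.1 i j) (x.A i j) 0
  X : ∀ i, HasDerivAt (fun t => (γ t).X i) (x.ξ i) 0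
  κ : HasDerivAt (fun t => (γ t).κ) x.r 0

/-- Every element of the Lie algebra is the velocity of a curve in the group. -/
theorem exists_hasVelocityAtOne (x : JacobiAlgebra) : ∃ γ, HasVelocityAtOne γ x := by
  have htr := x.trace_A
  rw [Matrix.trace_fin_two] at htr
  have hid := hasDerivAt_id' (0 : ℝ)
  have h1 : HasDerivAt (fun t : ℝ => Real.exp (t * x.A 0 0)) (x.A 0 0) 0 := by
    simpa using (hid.mul_const (x.A 0 0)).exp
  have h2 : HasDerivAt (fun t : ℝ => Real.exp (-(t * x.A 0 0))) (-x.A 0 0) 0 := by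
    simpa using (hid.mul_const (x.A 0 0)).neg.exp
  have h3 : HasDerivAt (fun t : ℝ => 1 + t ^ 2 * (x.A 0 1 * x.A 1 0)) 0 0 := by
    simpa using (((hasDerivAt_pow 2 (0 : ℝ)).mul_const (x.A 0 1 * x.A 1 0)).const_add 1)
  refine ⟨fun t => ⟨⟨!![(1 + t ^ 2 * (x.A 0 1 * x.A 1 0)) * Real.exp (t * x.A 0 0),
      t * x.A 0 1 * Real.exp (-(t * x.A 0 0)); t * x.A 1 0 * Real.exp (t * x.A 0 0),
      Real.exp (-(t * x.A 0 0))], ?_⟩, t • x.ξ, t * x.r⟩, ?_, ?_, ?_, ?_⟩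
  · rw [Matrix.det_fin_two_of]
    have : Real.exp (t * x.A 0 0) * Real.exp (-(t * x.A 0 0)) = 1 := by
      rw [← Real.exp_add]; simp
    linear_combination this
  · ext i j
    · fin_cases i <;> fin_cases j <;> simp [JacobiGroup.one_M]
    · simp [JacobiGroup.one_X]
    · simp [JacobiGroup.one_κ]
  · intro i j
    fin_cases i <;> fin_cases j
    · exact (h3.mul h1).congr_deriv (by simp)
    · exact ((hid.mul_const (x.A 0 1)).mul h2).congr_deriv (by simp)
    · exact ((hid.mul_const (x.A 1 0)).mul h1).congr_deriv (by simp)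
    · exact h2.congr_deriv (by simp; linarith)
  · intro i
    simpa using hid.mul_const (x.ξ i)
  · simpa using hid.mul_const x.r

/-! ### Adjoint and coadjoint representations, coadjoint orbits -/

/-- The adjoint representation, in explicit form; see `hasVelocityAtOne_conj`. -/
def Ad (g : JacobiGroup) : JacobiAlgebra →ₗ[ℝ] JacobiAlgebra where
  toFun x := JacobiAlgebra.mk (g.M.1 * x.A * (g.M⁻¹).1)
    (by
      rw [Matrix.trace_mul_comm, ← Matrix.mul_assoc, ← Matrix.SpecialLinearGroup.coe_mul,
        inv_mul_cancel, Matrix.SpecialLinearGroup.coe_one, Matrix.one_mul, x.trace_A])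
    ((g.X ᵥ* x.A + x.ξ) ᵥ* (g.M⁻¹).1)
    (x.r + 2 * Om g.X x.ξ + Om g.X (g.X ᵥ* x.A))
  map_add' x y := by
    refine JacobiAlgebra.ext ?_ ?_ ?_
    · simp [Matrix.mul_add, Matrix.add_mul]
    · simp only [JacobiAlgebra.ξ_mk, JacobiAlgebra.ξ_add, JacobiAlgebra.A_add,
        Matrix.add_vecMul, Matrix.vecMul_add]
      abel_nf
    · simp only [JacobiAlgebra.r_mk, JacobiAlgebra.r_add, JacobiAlgebra.ξ_add,
        JacobiAlgebra.A_add, Matrix.vecMul_add, Om, Pi.add_apply]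
      ring
  map_smul' c x := by
    refine JacobiAlgebra.ext ?_ ?_ ?_
    · simp
    · simp [Matrix.vecMul_smul, Matrix.smul_vecMul, ← smul_add]
    · simp only [JacobiAlgebra.r_mk, JacobiAlgebra.r_smul, JacobiAlgebra.ξ_smul,
        JacobiAlgebra.A_smul, Matrix.vecMul_smul, Om, Pi.smul_apply, smul_eq_mul,
        RingHom.id_apply]
      ring

/-- `Ad g` is the derivative at the identity of the conjugation by `g`. -/
theorem hasVelocityAtOne_conj (g : JacobiGroup) {γ : ℝ → JacobiGroup} {x : JacobiAlgebra}
    (h : HasVelocityAtOne γ x) : HasVelocityAtOne (fun t => g * γ t * g⁻¹) (Ad g x) := by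
  have hdet := JacobiGroup.det_eq g.M
  have h0M : ∀ i j, (γ 0).M.1 i j = (1 : Matrix (Fin 2) (Fin 2) ℝ) i j := by
    intro i j; rw [h.zero]; rfl
  have h0X : ∀ i, (γ 0).X i = 0 := by intro i; rw [h.zero]; rfl
  have hM : ∀ c : Fin 2 → ℝ, ∀ j, HasDerivAt (fun t => (c ᵥ* (γ t).M.1) j)
      ((c ᵥ* x.A) j) 0 := by
    intro c j
    have e : ∀ (B : Matrix (Fin 2) (Fin 2) ℝ), (c ᵥ* B) j = c 0 * B 0 j + c 1 * B 1 j := by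
      intro B; simp [Matrix.vecMul, dotProduct, Fin.sum_univ_two]
    simp only [e]
    exact ((h.M 0 j).const_mul _).add ((h.M 1 j).const_mul _)
  have hXM : ∀ j, HasDerivAt (fun t => ((g.X ᵥ* (γ t).M.1) + (γ t).X) j)
      ((g.X ᵥ* x.A + x.ξ) j) 0 := fun j => (hM g.X j).add (h.X j)
  have hY : ∀ j, HasDerivAt (fun t => (((g.X ᵥ* (γ t).M.1) + (γ t).X) ᵥ* (g.M⁻¹).1) j)
      (((g.X ᵥ* x.A + x.ξ) ᵥ* (g.M⁻¹).1) j) 0 := by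
    intro j
    have e : ∀ (c : Fin 2 → ℝ) (B : Matrix (Fin 2) (Fin 2) ℝ),
        (c ᵥ* B) j = c 0 * B 0 j + c 1 * B 1 j := by
      intro c B; simp [Matrix.vecMul, dotProduct, Fin.sum_univ_two]
    simp only [e]
    exact ((hXM 0).mul_const _).add ((hXM 1).mul_const _)
  refine ⟨by simp [h.zero], ?_, ?_, ?_⟩
  · intro i j
    have e : ∀ t, (g * γ t * g⁻¹).M.1 i j =
        (((g.M.1 i) ᵥ* (γ t).M.1) 0) * (g.M⁻¹).1 0 j +
        (((g.M.1 i) ᵥ* (γ t).M.1) 1) * (g.M⁻¹).1 1 j := by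
      intro t
      simp [JacobiGroup.mul_M, JacobiGroup.inv_M, Matrix.mul_apply, Matrix.vecMul, dotProduct,
        Fin.sum_univ_two]
    simp only [e]
    refine (((hM (g.M.1 i) 0).mul_const ((g.M⁻¹).1 0 j)).add
      ((hM (g.M.1 i) 1).mul_const ((g.M⁻¹).1 1 j))).congr_deriv ?_
    simp [Ad, Matrix.mul_apply, Matrix.vecMul, dotProduct, Fin.sum_univ_two]
  · intro i
    have e : ∀ t, (g * γ t * g⁻¹).X i =
        (((g.X ᵥ* (γ t).M.1) + (γ t).X) ᵥ* (g.M⁻¹).1) i - (g.X ᵥ* (g.M⁻¹).1) i := by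
      intro t
      simp [JacobiGroup.mul_X, JacobiGroup.inv_M, JacobiGroup.inv_X, sub_eq_add_neg]
    simp only [e]
    exact (hY i).sub_const _
  · have e : ∀ t, (g * γ t * g⁻¹).κ =
        (γ t).κ + Om (g.X ᵥ* (γ t).M.1) (γ t).X
          - Om ((g.X ᵥ* (γ t).M.1) + (γ t).X) g.X := by
      intro t
      have := JacobiGroup.Om_vecMul g.M⁻¹ ((g.X ᵥ* (γ t).M.1) + (γ t).X) g.X
      simp only [JacobiGroup.mul_κ, JacobiGroup.inv_κ, JacobiGroup.mul_X, JacobiGroup.inv_M,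
        JacobiGroup.inv_X]
      rw [← this]
      simp only [Om, Pi.neg_apply]
      ring
    simp only [e, Om]
    have d := (h.κ.add (((hM g.X 0).mul (h.X 1)).sub ((hM g.X 1).mul (h.X 0)))).sub
      (((hXM 0).mul_const (g.X 1)).sub ((hXM 1).mul_const (g.X 0)))
    refine d.congr_deriv ?_
    simp only [Ad, LinearMap.coe_mk, AddHom.coe_mk, JacobiAlgebra.r_mk, Om, h0X, Pi.add_apply,
      Matrix.vecMul, dotProduct, Fin.sum_univ_two, h0M, Matrix.one_apply]
    simp
    ring

/-- The coadjoint representation: `⟨Ad* g α, x⟩ = ⟨α, Ad g⁻¹ x⟩`. -/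
def coAd (g : JacobiGroup) (α : JacobiDual) : JacobiDual :=
  α.comp (LinearMap.toContinuousLinearMap (Ad g⁻¹))

/-- The coadjoint orbit through `μ`. -/
def coadjointOrbit (μ : JacobiDual) : Set JacobiDual := {α | ∃ g : JacobiGroup, α = coAd g μ}

/-- The functional `ad* x α`, where `⟨ad* x α, y⟩ = ⟨α, [x, y]⟩`. -/
def coad (x : JacobiAlgebra) (α : JacobiDual) : JacobiDual :=
  α.comp (LinearMap.toContinuousLinearMap (LieAlgebra.ad ℝ JacobiAlgebra x))

theorem coad_apply (x : JacobiAlgebra) (α : JacobiDual) (y : JacobiAlgebra) :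
    coad x α y = α ⁅x, y⁆ := rfl


/-- The pairing `(ad* x α, ad* y α) ↦ ⟨α, [x, y]⟩` defining the Kirillov-Kostant-Souriau form
(it does not depend on the choice of `x` and `y`, see `kks_coad`). -/
def kks (α u v : JacobiDual) : ℝ :=
  open Classical in
  if h : (∃ x, coad x α = u) ∧ (∃ y, coad y α = v) then α ⁅h.1.choose, h.2.choose⁆ else 0

theorem kks_coad (α : JacobiDual) (x y : JacobiAlgebra) :
    kks α (coad x α) (coad y α) = α ⁅x, y⁆ := by
  have h : (∃ x', coad x' α = coad x α) ∧ (∃ y', coad y' α = coad y α) := ⟨⟨x, rfl⟩, ⟨y, rfl⟩⟩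
  rw [kks, dif_pos h, ← coad_apply, h.1.choose_spec, coad_apply, ← lie_skew, map_neg,
    ← coad_apply, h.2.choose_spec, coad_apply, ← map_neg, lie_skew]

/-- A charted space structure on the coadjoint orbit through `μ` (with its subspace topology) is
its structure of immersed submanifold of the dual: it is smooth, the inclusion is a smooth
immersion, and the tangent space at `α` is `{ad* x α}`, the image of the derivative of the orbit
map `g ↦ Ad* g α` at the identity. -/
structure IsOrbitManifold (μ : JacobiDual)
    [ChartedSpace (EuclideanSpace ℝ (Fin 4)) (coadjointOrbit μ)] : Prop where
  isManifold : IsManifold (𝓡 4) ∞ (coadjointOrbit μ)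
  contMDiff_coe :
    ContMDiff (𝓡 4) 𝓘(ℝ, JacobiDual) ∞ (Subtype.val : coadjointOrbit μ → JacobiDual)
  injective_mfderiv_coe : ∀ α : coadjointOrbit μ, Function.Injective
    (mfderiv (𝓡 4) 𝓘(ℝ, JacobiDual) (Subtype.val : coadjointOrbit μ → JacobiDual) α)
  range_mfderiv_coe : ∀ α : coadjointOrbit μ, Set.range
    (mfderiv (𝓡 4) 𝓘(ℝ, JacobiDual) (Subtype.val : coadjointOrbit μ → JacobiDual) α) =
    {u : JacobiDual | ∃ x : JacobiAlgebra, u = coad x α}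

/-- The Kirillov-Kostant-Souriau form on the coadjoint orbit through `μ`. -/
def orbitForm {μ : JacobiDual} [ChartedSpace (EuclideanSpace ℝ (Fin 4)) (coadjointOrbit μ)]
    (α : coadjointOrbit μ) (u v : TangentSpace (𝓡 4) α) : ℝ :=
  kks α
    (mfderiv (𝓡 4) 𝓘(ℝ, JacobiDual) (Subtype.val : coadjointOrbit μ → JacobiDual) α u)
    (mfderiv (𝓡 4) 𝓘(ℝ, JacobiDual) (Subtype.val : coadjointOrbit μ → JacobiDual) α v)

/-! ### The Siegel-Jacobi space and its momentum map -/

/-- The model of `ℍ × ℂ` as a real smooth manifold. Tangent vectors at `(τ, z)`, with `τ = u + iv`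
and `z = x + iy`, are pairs of complex numbers `(du + i dv, dx + i dy)`. -/
abbrev modelSJ : ModelWithCorners ℝ (ℂ × ℂ) (ModelProd ℂ ℂ) := 𝓘(ℝ, ℂ).prod 𝓘(ℝ, ℂ)

/-- The metric `g_{A,B}` on `ℍ × ℂ`. -/
def gAB (A B : ℝ) (p : ℍ × ℂ) (a b : ℂ × ℂ) : ℝ :=
  (A * p.1.im + B * p.2.im ^ 2) / p.1.im ^ 3 * (a.1.re * b.1.re + a.1.im * b.1.im)
    - B * p.2.im / p.1.im ^ 2 *
      (a.1.re * b.2.re + a.2.re * b.1.re + a.1.im * b.2.im + a.2.im * b.1.im)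
    + B / p.1.im * (a.2.re * b.2.re + a.2.im * b.2.im)

/-- The Kähler-Berndt metric `(1/2) g_{1,1}`. -/
def gKB (p : ℍ × ℂ) (a b : ℂ × ℂ) : ℝ := 1 / 2 * gAB 1 1 p a b

/-- The Kähler-Berndt symplectic form `ω(a, b) = g(i a, b)`. -/
def omegaKB (p : ℍ × ℂ) (a b : ℂ × ℂ) : ℝ := gKB p (Complex.I • a) b

/-- `a` is the value at `p` of the fundamental vector field of `x`: the velocity at time `0` of
`γ t • p`, for curves `γ` through the identity of velocity `x` (for instance `γ t = exp (t x)`). -/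
def IsFundamentalVector (x : JacobiAlgebra) (p : ℍ × ℂ) (a : ℂ × ℂ) : Prop :=
  ∀ γ : ℝ → JacobiGroup, HasVelocityAtOne γ x →
    HasDerivAt (fun t => (((γ t • p).1 : ℂ), (γ t • p).2)) a 0

/-- `J` is a momentum map for the action of the Jacobi group on `(ℍ × ℂ, omegaKB)`: it is smooth
and the fundamental vector field of `x` is the Hamiltonian vector field of `p ↦ J p x`, where the
Hamiltonian vector field `X_f` of `f` is defined by `ω(X_f, ·) = df`. -/
structure IsMomentumMap (J : ℍ × ℂ → JacobiDual) : Prop where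
  contMDiff : ContMDiff modelSJ 𝓘(ℝ, JacobiDual) ∞ J
  hamiltonian : ∀ (x : JacobiAlgebra) (p : ℍ × ℂ), ∃ a : ℂ × ℂ, IsFundamentalVector x p a ∧
    ∀ b : TangentSpace modelSJ p,
      omegaKB p a b = mfderiv modelSJ 𝓘(ℝ, ℝ) (fun q => J q x) p b

/-- The natural parameter `θ₁` of the Gaussian family, as a function on `ℍ × ℂ`, which is identified
with the tangent bundle of the family by `(u, v, x, y) = (dθ₂, -θ₂, -dθ₁, θ₁)`. -/
def θ₁ (p : ℍ × ℂ) : ℝ := p.2.im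

/-- The natural parameter `θ₂ < 0`. -/
def θ₂ (p : ℍ × ℂ) : ℝ := -p.1.im

/-- The differential of `θ₁`, as a function on the tangent bundle. -/
def dθ₁ (p : ℍ × ℂ) : ℝ := -p.2.re

/-- The differential of `θ₂`, as a function on the tangent bundle. -/
def dθ₂ (p : ℍ × ℂ) : ℝ := p.1.re

/-- The first expectation parameter. -/
def η₁ (p : ℍ × ℂ) : ℝ := -θ₁ p / (2 * θ₂ p)

/-- The second expectation parameter. -/
def η₂ (p : ℍ × ℂ) : ℝ := (θ₁ p ^ 2 - 2 * θ₂ p) / (4 * θ₂ p ^ 2)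

/-- The linear map `x ↦ ψ(x)(p)`, given on the basis `F, G, H, P, Q, R` and written for
`x = x.A 0 1 • F + x.A 1 0 • G + x.A 0 0 • H + x.ξ 0 • P + x.ξ 1 • Q + x.r • R`. -/
def psi (p : ℍ × ℂ) : JacobiAlgebra →ₗ[ℝ] ℝ where
  toFun x :=
    x.A 0 1 * (-η₂ p)
    + x.A 1 0 * (1 / 4 * dθ₁ p ^ 2 + η₂ p * dθ₂ p ^ 2 + η₁ p * dθ₁ p * dθ₂ p
        - 1 / (4 * (η₁ p ^ 2 - η₂ p)))
    + x.A 0 0 * (-η₁ p * dθ₁ p - 2 * η₂ p * dθ₂ p)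
    + x.ξ 0 * (1 / 2 * dθ₁ p + η₁ p * dθ₂ p)
    + x.ξ 1 * η₁ p
    + x.r * (-1 / 4)
  map_add' x y := by
    simp only [JacobiAlgebra.A_add, JacobiAlgebra.ξ_add, JacobiAlgebra.r_add, Matrix.add_apply,
      Pi.add_apply]
    ring
  map_smul' c x := by
    simp only [JacobiAlgebra.A_smul, JacobiAlgebra.ξ_smul, JacobiAlgebra.r_smul,
      Matrix.smul_apply, Pi.smul_apply, smul_eq_mul, RingHom.id_apply]
    ring

/-- The momentum map `J(p)(x) = ψ(x)(p)`. -/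
def momentumMap (p : ℍ × ℂ) : JacobiDual := LinearMap.toContinuousLinearMap (psi p)

end SiegelJacobi

end

noncomputable section

namespace SiegelJacobi

/-! Write X_x for the fundamental vector field of x. Everything rests on two identities, checked in
the real coordinates u, v, x, y of the half-space: d(ψ(x)) = ω(X_x, ·) (`hasDerivAt_psiModel_line`)
and ω(X_x, X_y) = ψ([x, y]) (`omegaModel_fundamentalVector`). The first is the momentum map
property. The fields X_x span every tangent space (`exists_fundamentalVector_eq`) and ω is
nondegenerate (`eq_zero_of_omegaModel_eq_zero`). Hence dJ(b) = 0 forces b = 0, and dJ(X_x) = ad*(-x)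
J(p), so that dJ maps the tangent space isomorphically onto {ad*(x) J(p)}. The second identity then
says that the KKS form pulls back to ω, the two minus signs cancelling. Globally, the group acts
transitively on the space and J(g • p₀) = Ad*(g) J(p₀) at the base point p₀ = (i, 0), so the image
is the orbit of J(p₀). On this orbit the four linear coordinates α(F), α(Q), α(P), α(H) determine
the point p with α = J(p), by a formula that is smooth on an open subset of ℝ⁴. They therefore form
one global chart for the subspace topology, in which J and its inverse are smooth. -/

/-! ### Infinitesimal action and the differential of the momentum map -/

/-- The inclusion of the Siegel-Jacobi space in its model vector space. -/
def inclSJ (p : ℍ × ℂ) : ℂ × ℂ := ((p.1 : ℂ), p.2)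

/-- The value at `w` of the fundamental vector field of `x`. -/
def fundamentalVector (x : JacobiAlgebra) (w : ℂ × ℂ) : ℂ × ℂ :=
  (x.A 0 0 * w.1 + x.A 0 1 - w.1 * (x.A 1 0 * w.1 + x.A 1 1),
    x.ξ 0 * w.1 + x.ξ 1 - w.2 * (x.A 1 0 * w.1 + x.A 1 1))

/-- This is the quotient rule at `γ 0 = 1`, where the denominator cτ + d equals 1. -/
theorem isFundamentalVector_fundamentalVector (x : JacobiAlgebra) (p : ℍ × ℂ) :
    IsFundamentalVector x p (fundamentalVector x (inclSJ p)) := by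
  intro γ h
  have hM : ∀ i j, HasDerivAt (fun t => (((γ t).M.1 i j : ℝ) : ℂ)) ((x.A i j : ℝ) : ℂ) 0 :=
    fun i j => (h.M i j).ofReal_comp
  have hX : ∀ i, HasDerivAt (fun t => (((γ t).X i : ℝ) : ℂ)) ((x.ξ i : ℝ) : ℂ) 0 :=
    fun i => (h.X i).ofReal_comp
  have h0M : ∀ i j, (γ 0).M.1 i j = (1 : Matrix (Fin 2) (Fin 2) ℝ) i j := by
    intro i j; rw [h.zero]; rfl
  have h0X : ∀ i, (γ 0).X i = 0 := by intro i; rw [h.zero]; rfl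
  have hD := ((hM 1 0).mul_const (p.1 : ℂ)).add (hM 1 1)
  have hD0 := JacobiGroup.denom_ne_zero (γ 0).M p.1
  have h1 := (((hM 0 0).mul_const (p.1 : ℂ)).add (hM 0 1)).div hD hD0
  have h2 := ((((hX 0).mul_const (p.1 : ℂ)).const_add p.2).add (hX 1)).div hD hD0
  refine ((h1.congr_deriv ?_).prodMk (h2.congr_deriv ?_)).congr_of_eventuallyEq
    (Filter.Eventually.of_forall fun t => ?_)
  · simp [inclSJ, h0M]
  · simp [inclSJ, h0M, h0X]
  · exact Prod.ext (JacobiGroup.coe_smul_fst _ _) (JacobiGroup.smul_snd _ _)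

/-- The functions `ψ(x)` on the model vector space. -/
def psiModel (w : ℂ × ℂ) (x : JacobiAlgebra) : ℝ :=
  -(x.A 0 1) * (w.2.im ^ 2 / (4 * w.1.im ^ 2) + 1 / (2 * w.1.im))
    + x.A 1 0 * (w.2.re ^ 2 / 4 + (w.2.im ^ 2 / (4 * w.1.im ^ 2) + 1 / (2 * w.1.im)) * w.1.re ^ 2
        - w.2.im / (2 * w.1.im) * w.2.re * w.1.re + w.1.im / 2)
    + x.A 0 0 * (w.2.im / (2 * w.1.im) * w.2.re
        - 2 * (w.2.im ^ 2 / (4 * w.1.im ^ 2) + 1 / (2 * w.1.im)) * w.1.re)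
    + x.ξ 0 * (-(w.2.re / 2) + w.2.im / (2 * w.1.im) * w.1.re)
    + x.ξ 1 * (w.2.im / (2 * w.1.im)) - x.r / 4

theorem momentumMap_apply (p : ℍ × ℂ) (x : JacobiAlgebra) :
    momentumMap p x = psiModel (inclSJ p) x := by
  have hv : p.1.im ≠ 0 := p.1.im_pos.ne'
  have e1 : η₁ p = p.2.im / (2 * p.1.im) := by
    simp only [η₁, θ₁, θ₂]; field_simp
  have e2 : η₂ p = p.2.im ^ 2 / (4 * p.1.im ^ 2) + 1 / (2 * p.1.im) := by
    simp only [η₂, θ₁, θ₂]; field_simp; ring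
  -- The variance η₂ - η₁² of the Gaussian is 1/(2v).
  have e3 : 1 / (4 * (η₁ p ^ 2 - η₂ p)) = -(p.1.im / 2) := by
    have : η₁ p ^ 2 - η₂ p = -(1 / (2 * p.1.im)) := by
      rw [e1, e2]; field_simp; ring
    rw [this]; field_simp; norm_num
  change psi p x = _
  simp only [psi, LinearMap.coe_mk, AddHom.coe_mk, e3]
  rw [e1, e2]
  simp only [dθ₁, dθ₂, psiModel, inclSJ, UpperHalfPlane.coe_re, UpperHalfPlane.coe_im]
  ring

/-- The symplectic form on the model vector space. -/
def omegaModel (w a b : ℂ × ℂ) : ℝ :=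
  1 / 2 * ((w.1.im + w.2.im ^ 2) / w.1.im ^ 3 * (a.1.re * b.1.im - a.1.im * b.1.re)
    - w.2.im / w.1.im ^ 2 *
      (a.1.re * b.2.im - a.1.im * b.2.re + a.2.re * b.1.im - a.2.im * b.1.re)
    + 1 / w.1.im * (a.2.re * b.2.im - a.2.im * b.2.re))

theorem omegaKB_eq (p : ℍ × ℂ) (a b : ℂ × ℂ) : omegaKB p a b = omegaModel (inclSJ p) a b := by
  simp [omegaKB, gKB, gAB, omegaModel, inclSJ]
  ring

theorem hasDerivAt_psiModel_line (x : JacobiAlgebra) {w : ℂ × ℂ} (hw : 0 < w.1.im) (b : ℂ × ℂ) :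
    HasDerivAt (fun t : ℝ => psiModel (w + t • b) x)
      (omegaModel w (fundamentalVector x w) b) 0 := by
  have hl : ∀ c d : ℝ, HasDerivAt (fun t : ℝ => c + t * d) d 0 := fun c d => by
    simpa using ((hasDerivAt_id' (0 : ℝ)).mul_const d).const_add c
  have hv0 := hw.ne'
  have hu := hl w.1.re b.1.re
  have hv := hl w.1.im b.1.im
  have hx := hl w.2.re b.2.re
  have hy := hl w.2.im b.2.im
  -- `d1` and `d2` differentiate η₁ and η₂; `key` assembles them following the shape of `psiModel`.
  have d1 := hy.div (hv.const_mul 2) (by simpa using hv0)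
  have d2 := ((hy.pow 2).div ((hv.pow 2).const_mul 4) (by simpa using hv0)).add
    ((hasDerivAt_const (0 : ℝ) (1 : ℝ)).div (hv.const_mul 2) (by simpa using hv0))
  have key := (((((d2.const_mul (-(x.A 0 1))).add
    (((((hx.pow 2).div_const 4).add (d2.mul (hu.pow 2))).sub ((d1.mul hx).mul hu)).add
      (hv.div_const 2) |>.const_mul (x.A 1 0))).add
    (((d1.mul hx).sub ((d2.const_mul 2).mul hu)).const_mul (x.A 0 0))).add
    (((hx.div_const 2).neg.add (d1.mul hu)).const_mul (x.ξ 0))).add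
    (d1.const_mul (x.ξ 1))).sub_const (x.r / 4)
  have htr := x.trace_A
  rw [Matrix.trace_fin_two] at htr
  -- `psiModel` does not involve the entry `x.A 1 1` but `fundamentalVector` does, so the two sides
  -- agree only modulo the trace condition.
  have h11 : x.A 1 1 = -x.A 0 0 := by linarith
  refine (key.congr_deriv ?_).congr_of_eventuallyEq (Filter.Eventually.of_forall fun t => ?_)
  · simp [omegaModel, fundamentalVector, h11]
    field_simp
    ring
  · simp [psiModel]

/-- Infinitesimal equivariance. The centre acts trivially, yet ψ(R) is not free: ω(X_P, X_Q) = -1/2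
and [P, Q] = 2R force ψ(R) = -1/4. -/
theorem omegaModel_fundamentalVector (x y : JacobiAlgebra) {w : ℂ × ℂ} (hw : 0 < w.1.im) :
    omegaModel w (fundamentalVector x w) (fundamentalVector y w) = psiModel w ⁅x, y⁆ := by
  have hv0 := hw.ne'
  have hx := x.trace_A
  have hy := y.trace_A
  rw [Matrix.trace_fin_two] at hx hy
  have hx1 : x.A 1 1 = -x.A 0 0 := by linarith
  have hy1 : y.A 1 1 = -y.A 0 0 := by linarith
  simp [omegaModel, fundamentalVector, psiModel, JacobiAlgebra.A_lie, JacobiAlgebra.ξ_lie,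
    JacobiAlgebra.r_lie, Om, Matrix.mul_apply, Matrix.vecMul, dotProduct, Fin.sum_univ_two,
    hx1, hy1]
  field_simp
  ring

theorem exists_fundamentalVector_eq {w : ℂ × ℂ} (hw : 0 < w.1.im) (a : ℂ × ℂ) :
    ∃ x, fundamentalVector x w = a := by
  have hv0 := hw.ne'
  -- Upper triangular matrices and translations suffice. With `x.A 1 0 = 0` the equations are
  -- triangular: the imaginary part of `a.1` gives the diagonal, its real part the upper entry, and
  -- then `a.2` gives ξ.
  refine ⟨JacobiAlgebra.mk !![a.1.im / (2 * w.1.im),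
      a.1.re - a.1.im / w.1.im * w.1.re; 0, -(a.1.im / (2 * w.1.im))] (by simp [Matrix.trace_fin_two])
    ![(a.2.im - a.1.im / (2 * w.1.im) * w.2.im) / w.1.im,
      a.2.re - a.1.im / (2 * w.1.im) * w.2.re
        - (a.2.im - a.1.im / (2 * w.1.im) * w.2.im) / w.1.im * w.1.re] 0, ?_⟩
  refine Prod.ext (Complex.ext ?_ ?_) (Complex.ext ?_ ?_) <;>
  · simp only [fundamentalVector, JacobiAlgebra.A_mk, JacobiAlgebra.ξ_mk, Matrix.of_apply,
      Matrix.cons_val', Matrix.cons_val_zero, Matrix.cons_val_one, Matrix.cons_val_fin_one,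
      Complex.sub_re, Complex.add_re, Complex.mul_re, Complex.sub_im, Complex.add_im,
      Complex.mul_im, Complex.ofReal_re, Complex.ofReal_im]
    field_simp
    ring

/-- Nondegeneracy of the symplectic form. -/
theorem eq_zero_of_omegaModel_eq_zero {w : ℂ × ℂ} (hw : 0 < w.1.im) {b : ℂ × ℂ}
    (h : ∀ a, omegaModel w a b = 0) : b = 0 := by
  have hv0 := hw.ne'
  have h1 := h (0, 1)
  have h2 := h (0, Complex.I)
  have h3 := h (1, 0)
  have h4 := h (Complex.I, 0)
  simp only [omegaModel, Complex.zero_re, Complex.zero_im, Complex.one_re, Complex.one_im,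
    Complex.I_re, Complex.I_im] at h1 h2 h3 h4
  field_simp at h1 h2 h3 h4
  have hv2 := pow_ne_zero 2 hv0
  -- `h1` and `h3` involve only imaginary parts of `b`, `h2` and `h4` only real parts. Each
  -- combination eliminates the component of `b.2`.
  have i1 : b.1.im = 0 := (mul_eq_zero.mp
    (by linear_combination w.1.im * h3 + w.2.im * h1 : w.1.im ^ 2 * b.1.im = 0)).resolve_left hv2
  have i2 : b.1.re = 0 := (mul_eq_zero.mp
    (by linear_combination -w.1.im * h4 - w.2.im * h2 :
      w.1.im ^ 2 * b.1.re = 0)).resolve_left hv2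
  rw [i1] at h1
  rw [i2] at h2
  refine Prod.ext (Complex.ext i2 i1) (Complex.ext ?_ ?_)
  · exact (mul_eq_zero.mp (by linear_combination -h2 : w.1.im ^ 2 * b.2.re = 0)).resolve_left hv2
  · exact (mul_eq_zero.mp (by linear_combination h1 : w.1.im ^ 2 * b.2.im = 0)).resolve_left hv2

/-! ### The image of the momentum map is a coadjoint orbit -/

/-- The base point `(i, 0)`. -/
def basePoint : ℍ × ℂ := (UpperHalfPlane.I, 0)

/-- The value of the momentum map at the base point. -/
def baseDual : JacobiDual := momentumMap basePoint

theorem inclSJ_smul_basePoint (g : JacobiGroup) : inclSJ (g • basePoint) =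
    (⟨(g.M.1 0 0 * g.M.1 1 0 + g.M.1 0 1 * g.M.1 1 1) / (g.M.1 1 0 ^ 2 + g.M.1 1 1 ^ 2),
        1 / (g.M.1 1 0 ^ 2 + g.M.1 1 1 ^ 2)⟩,
      ⟨(g.X 0 * g.M.1 1 0 + g.X 1 * g.M.1 1 1) / (g.M.1 1 0 ^ 2 + g.M.1 1 1 ^ 2),
        (g.X 0 * g.M.1 1 1 - g.X 1 * g.M.1 1 0) / (g.M.1 1 0 ^ 2 + g.M.1 1 1 ^ 2)⟩) := by
  have hdet := JacobiGroup.det_eq g.M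
  have hD := JacobiGroup.denom_ne_zero g.M UpperHalfPlane.I
  have hN : g.M.1 1 0 ^ 2 + g.M.1 1 1 ^ 2 ≠ 0 := by
    intro h0
    have h1 : g.M.1 1 0 = 0 := by nlinarith [sq_nonneg (g.M.1 1 0), sq_nonneg (g.M.1 1 1)]
    have h2 : g.M.1 1 1 = 0 := by nlinarith [sq_nonneg (g.M.1 1 0), sq_nonneg (g.M.1 1 1)]
    rw [h1, h2] at hdet
    norm_num at hdet
  refine Prod.ext ((JacobiGroup.coe_smul_fst g basePoint).trans ?_)
    ((JacobiGroup.smul_snd g basePoint).trans ?_)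
  · refine (div_eq_iff hD).mpr (Complex.ext ?_ ?_) <;> simp [basePoint] <;> field_simp
    · linear_combination (-g.M.1 1 0) * hdet
    · linear_combination g.M.1 1 1 * hdet
  · refine (div_eq_iff hD).mpr (Complex.ext ?_ ?_) <;> simp [basePoint] <;> field_simp <;> ring

/-- Equivariance at a single point is enough, because the action is transitive. -/
theorem momentumMap_smul_basePoint (g : JacobiGroup) :
    momentumMap (g • basePoint) = coAd g baseDual := by
  ext x
  have hdet := JacobiGroup.det_eq g.M
  have htr := x.trace_A
  rw [Matrix.trace_fin_two] at htr
  have h11 : x.A 1 1 = -x.A 0 0 := by linarith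
  change _ = momentumMap basePoint (Ad g⁻¹ x)
  have hN : 0 < g.M.1 1 0 ^ 2 + g.M.1 1 1 ^ 2 := by
    have := (g • basePoint).1.im_pos
    rw [← UpperHalfPlane.coe_im, show (((g • basePoint).1 : ℍ) : ℂ) = _ from
      congrArg Prod.fst (inclSJ_smul_basePoint g)] at this
    exact one_div_pos.mp this
  rw [momentumMap_apply, momentumMap_apply, inclSJ_smul_basePoint]
  have hN0 := hN.ne'
  have hM : (g.M⁻¹).1 = !![g.M.1 1 1, -g.M.1 0 1; -g.M.1 1 0, g.M.1 0 0] :=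
    congrArg Subtype.val (Matrix.SpecialLinearGroup.SL2_inv_expl g.M)
  simp only [psiModel, Ad, LinearMap.coe_mk, AddHom.coe_mk, JacobiAlgebra.A_mk, JacobiAlgebra.ξ_mk,
    JacobiAlgebra.r_mk, JacobiGroup.inv_M, JacobiGroup.inv_X, inv_inv, hM, inclSJ, basePoint,
    UpperHalfPlane.coe_I, Complex.I_re, Complex.I_im, Complex.zero_re, Complex.zero_im,
    Matrix.mul_apply, Matrix.vecMul, dotProduct, Fin.sum_univ_two, Om, Pi.add_apply, Pi.neg_apply,
    Matrix.of_apply, Matrix.cons_val', Matrix.cons_val_zero, Matrix.cons_val_one,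
    Matrix.cons_val_fin_one, h11]
  generalize g.M.1 0 0 = a at *
  generalize g.M.1 0 1 = b at *
  generalize g.M.1 1 0 = c at *
  generalize g.M.1 1 1 = d at *
  -- Here m is the real part of g • i. Expressing a and b through c, d, m solves the determinant
  -- equation, which leaves a rational identity in free variables.
  obtain ⟨m, hm⟩ : ∃ m, m = (a * c + b * d) / (c ^ 2 + d ^ 2) := ⟨_, rfl⟩
  have ha : a = d / (c ^ 2 + d ^ 2) + c * m := by
    rw [hm]; field_simp; linear_combination d * hdet
  have hb : b = d * m - c / (c ^ 2 + d ^ 2) := by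
    rw [hm]; field_simp; linear_combination (-c) * hdet
  rw [← hm, ha, hb]
  clear hm hdet ha hb
  field_simp
  ring

theorem exists_smul_basePoint (p : ℍ × ℂ) : ∃ g : JacobiGroup, g • basePoint = p := by
  have hv := p.1.im_pos
  have hs := Real.sqrt_pos.mpr hv
  have hs0 := hs.ne'
  have hsq := Real.sq_sqrt hv.le
  set s := √p.1.im
  -- The upper triangular matrix sends i to u + iv, and its denominator is 1/s, so the translation
  -- part must be (y/s, x/s).
  let g : JacobiGroup := ⟨⟨!![s, p.1.re / s; 0, 1 / s], by
    rw [Matrix.det_fin_two_of]; field_simp; ring⟩, ![p.2.im / s, p.2.re / s], 0⟩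
  have h := inclSJ_smul_basePoint g
  refine ⟨g, Prod.ext (UpperHalfPlane.ext ((congrArg Prod.fst h).trans ?_))
    ((congrArg Prod.snd h).trans ?_)⟩
  · refine Complex.ext ?_ ?_ <;> simp [g, hsq]
    field_simp
    exact congrArg _ hsq.symm
  · refine Complex.ext ?_ ?_ <;> simp [g] <;> field_simp

theorem range_momentumMap : Set.range momentumMap = coadjointOrbit baseDual := by
  ext α
  constructor
  · rintro ⟨p, rfl⟩
    obtain ⟨g, rfl⟩ := exists_smul_basePoint p
    exact ⟨g, momentumMap_smul_basePoint g⟩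
  · rintro ⟨g, rfl⟩
    exact ⟨g • basePoint, momentumMap_smul_basePoint g⟩

theorem momentumMap_mem (p : ℍ × ℂ) : momentumMap p ∈ coadjointOrbit baseDual :=
  range_momentumMap ▸ Set.mem_range_self p

/-! ### A global chart of the orbit -/

/-- The linear coordinates `(α(F), α(Q), α(P), α(H))` of a functional `α`. -/
def dualCoords (α : JacobiDual) : EuclideanSpace ℝ (Fin 4) :=
  !₂[α (JacobiAlgebra.mk !![0, 1; 0, 0] (by simp [Matrix.trace_fin_two]) 0 0),
    α (JacobiAlgebra.mk 0 (by simp) ![0, 1] 0),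
    α (JacobiAlgebra.mk 0 (by simp) ![1, 0] 0),
    α (JacobiAlgebra.mk !![1, 0; 0, -1] (by simp [Matrix.trace_fin_two]) 0 0)]

theorem continuous_dualCoords : Continuous dualCoords := by
  refine (PiLp.continuous_toLp 2 _).comp (continuous_pi fun i => ?_)
  fin_cases i <;> exact ContinuousLinearMap.continuous (ContinuousLinearMap.apply ℝ ℝ _)

theorem dualCoords_momentumMap (p : ℍ × ℂ) : dualCoords (momentumMap p) =
    !₂[-(p.2.im ^ 2 / (4 * p.1.im ^ 2) + 1 / (2 * p.1.im)), p.2.im / (2 * p.1.im),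
      -(p.2.re / 2) + p.2.im / (2 * p.1.im) * p.1.re, p.2.im / (2 * p.1.im) * p.2.re
        - 2 * (p.2.im ^ 2 / (4 * p.1.im ^ 2) + 1 / (2 * p.1.im)) * p.1.re] := by
  ext i
  fin_cases i <;> simp [dualCoords, momentumMap_apply, psiModel, inclSJ]

/-- The image of the orbit under `dualCoords`. -/
def coordsDomain : Set (EuclideanSpace ℝ (Fin 4)) := {w | 0 < -w 0 - w 1 ^ 2}

theorem isOpen_coordsDomain : IsOpen coordsDomain :=
  isOpen_lt continuous_const (by fun_prop)

/-- The point of the Siegel-Jacobi space with given coordinates. -/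
def pointOfCoords (w : EuclideanSpace ℝ (Fin 4)) : ℂ × ℂ :=
  (⟨-(2 * w 1 * w 2 + w 3) / (2 * (-w 0 - w 1 ^ 2)), 1 / (2 * (-w 0 - w 1 ^ 2))⟩,
    ⟨2 * (w 1 * (-(2 * w 1 * w 2 + w 3) / (2 * (-w 0 - w 1 ^ 2))) - w 2),
      w 1 / (-w 0 - w 1 ^ 2)⟩)

theorem contDiffOn_pointOfCoords : ContDiffOn ℝ ∞ pointOfCoords coordsDomain := by
  have hne : ∀ w ∈ coordsDomain, 2 * (-w 0 - w 1 ^ 2) ≠ 0 := fun w hw =>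
    mul_ne_zero two_ne_zero (ne_of_gt hw)
  have hne' : ∀ w ∈ coordsDomain, -w 0 - w 1 ^ 2 ≠ 0 := fun w hw => ne_of_gt hw
  have hmk : ∀ {f g : EuclideanSpace ℝ (Fin 4) → ℝ}, ContDiffOn ℝ ∞ f coordsDomain →
      ContDiffOn ℝ ∞ g coordsDomain →
      ContDiffOn ℝ ∞ (fun w => (⟨f w, g w⟩ : ℂ)) coordsDomain := fun hf hg =>
    Complex.equivRealProdCLM.symm.contDiff.comp_contDiffOn (hf.prodMk hg)
  have hu : ContDiffOn ℝ ∞ (fun w : EuclideanSpace ℝ (Fin 4) =>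
      -(2 * w 1 * w 2 + w 3) / (2 * (-w 0 - w 1 ^ 2))) coordsDomain :=
    ContDiffOn.div (by fun_prop) (by fun_prop) hne
  refine (hmk hu (ContDiffOn.div (by fun_prop) (by fun_prop) hne)).prodMk
    (hmk ?_ (ContDiffOn.div (by fun_prop) (by fun_prop) hne'))
  exact contDiffOn_const.mul ((ContDiffOn.mul (by fun_prop) hu).sub (by fun_prop))

/-- The inequality defining `coordsDomain` is positivity of the variance η₂ - η₁² = 1/(2v). Solving
for v, then y, then u and x yields `pointOfCoords`. -/
theorem dualCoords_momentumMap_mem (p : ℍ × ℂ) : dualCoords (momentumMap p) ∈ coordsDomain := by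
  have hv := p.1.im_pos
  have : -(dualCoords (momentumMap p)) 0 - (dualCoords (momentumMap p)) 1 ^ 2 =
      1 / (2 * p.1.im) := by
    rw [dualCoords_momentumMap]
    simp
    field_simp
    ring
  rw [coordsDomain, Set.mem_ofPred_eq, this]
  positivity

theorem pointOfCoords_dualCoords (p : ℍ × ℂ) :
    pointOfCoords (dualCoords (momentumMap p)) = inclSJ p := by
  have hv := p.1.im_pos.ne'
  have h : -(-(p.2.im ^ 2 / (4 * p.1.im ^ 2) + 1 / (2 * p.1.im))) - (p.2.im / (2 * p.1.im)) ^ 2 =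
      1 / (2 * p.1.im) := by
    field_simp
    ring
  rw [dualCoords_momentumMap]
  refine Prod.ext (Complex.ext ?_ ?_) (Complex.ext ?_ ?_) <;>
    simp only [pointOfCoords, inclSJ, Matrix.cons_val, h, UpperHalfPlane.coe_re,
      UpperHalfPlane.coe_im] <;> field_simp <;> ring

/-- `pointOfCoords` with values in the Siegel-Jacobi space. -/
def pointSJ (w : EuclideanSpace ℝ (Fin 4)) : ℍ × ℂ :=
  (UpperHalfPlane.ofComplex (pointOfCoords w).1, (pointOfCoords w).2)

theorem pointSJ_dualCoords (p : ℍ × ℂ) : pointSJ (dualCoords (momentumMap p)) = p := by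
  rw [pointSJ, pointOfCoords_dualCoords]
  exact Prod.ext (UpperHalfPlane.ofComplex_apply _) rfl

/-- `UpperHalfPlane.ofComplex` is a genuine inverse of the coercion only on the half-plane, which is
where membership in `coordsDomain` is needed. -/
theorem inclSJ_pointSJ {w : EuclideanSpace ℝ (Fin 4)} (hw : w ∈ coordsDomain) :
    inclSJ (pointSJ w) = pointOfCoords w := by
  have h : 0 < (pointOfCoords w).1.im := by
    have hw' : 0 < -w 0 - w 1 ^ 2 := hw
    change 0 < 1 / (2 * (-w 0 - w 1 ^ 2))
    positivity
  refine Prod.ext ?_ rfl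
  change ((UpperHalfPlane.ofComplex (pointOfCoords w).1 : ℍ) : ℂ) = _
  rw [UpperHalfPlane.ofComplex_apply_of_im_pos h]

theorem dualCoords_momentumMap_pointSJ {w : EuclideanSpace ℝ (Fin 4)} (hw : w ∈ coordsDomain) :
    dualCoords (momentumMap (pointSJ w)) = w := by
  have hw' : -w 0 - w 1 ^ 2 ≠ 0 := ne_of_gt hw
  have h := inclSJ_pointSJ hw
  have h1 : (pointSJ w).1.re = (pointOfCoords w).1.re := congrArg (fun q => q.1.re) h
  have h2 : (pointSJ w).1.im = (pointOfCoords w).1.im := congrArg (fun q => q.1.im) h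
  have h3 : (pointSJ w).2 = (pointOfCoords w).2 := rfl
  rw [dualCoords_momentumMap, h1, h2, h3]
  ext i
  fin_cases i <;> simp [pointOfCoords] <;> field_simp <;> ring

theorem continuous_inclSJ : Continuous inclSJ :=
  (UpperHalfPlane.continuous_coe.comp continuous_fst).prodMk continuous_snd

theorem isEmbedding_inclSJ : Topology.IsEmbedding inclSJ :=
  UpperHalfPlane.isOpenEmbedding_coe.isEmbedding.prodMap .id

theorem continuousOn_pointSJ : ContinuousOn pointSJ coordsDomain := by
  rw [isEmbedding_inclSJ.continuousOn_iff]
  exact contDiffOn_pointOfCoords.continuousOn.congr fun w hw => inclSJ_pointSJ hw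

theorem inclSJ_fst_im_pos (p : ℍ × ℂ) : 0 < (inclSJ p).1.im := p.1.im_pos

/-! ### Smooth extension of the momentum map to the model vector space -/

/-- `psiModel` as a map to the dual of the Lie algebra. -/
def momentumModel (w : ℂ × ℂ) : JacobiDual :=
  momentumMap (UpperHalfPlane.ofComplex w.1, w.2)

theorem momentumModel_apply {w : ℂ × ℂ} (hw : 0 < w.1.im) (x : JacobiAlgebra) :
    momentumModel w x = psiModel w x := by
  rw [momentumModel, momentumMap_apply, inclSJ, UpperHalfPlane.ofComplex_apply_of_im_pos hw]

theorem momentumModel_inclSJ (p : ℍ × ℂ) : momentumModel (inclSJ p) = momentumMap p := by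
  simp [momentumModel, inclSJ]

theorem isOpen_halfSpace : IsOpen {w : ℂ × ℂ | 0 < w.1.im} :=
  isOpen_lt continuous_const (Complex.continuous_im.comp continuous_fst)

theorem contDiffOn_momentumModel :
    ContDiffOn ℝ ∞ momentumModel {w : ℂ × ℂ | 0 < w.1.im} := by
  rw [contDiffOn_clm_apply]
  intro x
  refine ContDiffOn.congr (f := fun w => psiModel w x) ?_ fun w hw => momentumModel_apply hw x
  have hu : ContDiff ℝ ∞ fun w : ℂ × ℂ => w.1.re := Complex.reCLM.contDiff.comp contDiff_fst
  have hv : ContDiff ℝ ∞ fun w : ℂ × ℂ => w.1.im := Complex.imCLM.contDiff.comp contDiff_fst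
  have hx : ContDiff ℝ ∞ fun w : ℂ × ℂ => w.2.re := Complex.reCLM.contDiff.comp contDiff_snd
  have hy : ContDiff ℝ ∞ fun w : ℂ × ℂ => w.2.im := Complex.imCLM.contDiff.comp contDiff_snd
  have d1 : ContDiffOn ℝ ∞ (fun w : ℂ × ℂ => w.2.im / (2 * w.1.im)) {w | 0 < w.1.im} :=
    hy.contDiffOn.div (contDiff_const.mul hv).contDiffOn fun w hw =>
      mul_ne_zero two_ne_zero (ne_of_gt hw)
  have d2 : ContDiffOn ℝ ∞ (fun w : ℂ × ℂ => w.2.im ^ 2 / (4 * w.1.im ^ 2) + 1 / (2 * w.1.im))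
      {w | 0 < w.1.im} :=
    ((hy.pow 2).contDiffOn.div (contDiff_const.mul (hv.pow 2)).contDiffOn fun w hw =>
      mul_ne_zero four_ne_zero (pow_ne_zero 2 (ne_of_gt hw))).add
    (contDiffOn_const.div (contDiff_const.mul hv).contDiffOn fun w hw =>
      mul_ne_zero two_ne_zero (ne_of_gt hw))
  replace hu := hu.contDiffOn (s := {w | 0 < w.1.im})
  replace hv := hv.contDiffOn (s := {w | 0 < w.1.im})
  replace hx := hx.contDiffOn (s := {w | 0 < w.1.im})
  replace hy := hy.contDiffOn (s := {w | 0 < w.1.im})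
  exact (((((contDiffOn_const.mul d2).add (contDiffOn_const.mul
    (((((hx.pow 2).div_const 4).add (d2.mul (hu.pow 2))).sub ((d1.mul hx).mul hu)).add
      (hv.div_const 2)))).add
    (contDiffOn_const.mul ((d1.mul hx).sub ((contDiffOn_const.mul d2).mul hu)))).add
    (contDiffOn_const.mul ((hx.div_const 2).neg.add (d1.mul hu)))).add
    (contDiffOn_const.mul d1)).sub contDiffOn_const

theorem continuous_momentumMap : Continuous momentumMap := by
  have h : momentumMap = momentumModel ∘ inclSJ :=
    funext fun p => (momentumModel_inclSJ p).symm
  rw [h]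
  exact contDiffOn_momentumModel.continuousOn.comp_continuous continuous_inclSJ inclSJ_fst_im_pos

/-- The coordinates `dualCoords` on the orbit, as a partial homeomorphism. -/
def orbitChart : OpenPartialHomeomorph (coadjointOrbit baseDual) (EuclideanSpace ℝ (Fin 4)) where
  toFun α := dualCoords α
  invFun w := ⟨momentumMap (pointSJ w), momentumMap_mem _⟩
  source := Set.univ
  target := coordsDomain
  map_source' := by
    rintro ⟨α, hα⟩ -
    obtain ⟨p, rfl⟩ : α ∈ Set.range momentumMap := range_momentumMap ▸ hα
    exact dualCoords_momentumMap_mem p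
  map_target' _ _ := Set.mem_univ _
  left_inv' := by
    rintro ⟨α, hα⟩ -
    obtain ⟨p, rfl⟩ : α ∈ Set.range momentumMap := range_momentumMap ▸ hα
    exact Subtype.ext (congrArg momentumMap (pointSJ_dualCoords p))
  right_inv' _ hw := dualCoords_momentumMap_pointSJ hw
  open_source := isOpen_univ
  open_target := isOpen_coordsDomain
  continuousOn_toFun := (continuous_dualCoords.comp continuous_subtype_val).continuousOn
  continuousOn_invFun := by
    rw [Topology.IsEmbedding.subtypeVal.continuousOn_iff]
    exact continuous_momentumMap.comp_continuousOn continuousOn_pointSJ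

theorem isOpenEmbedding_orbitChart :
    Topology.IsOpenEmbedding fun α : coadjointOrbit baseDual => dualCoords α :=
  orbitChart.isOpenEmbedding rfl

instance : Nonempty (coadjointOrbit baseDual) := ⟨⟨_, momentumMap_mem basePoint⟩⟩

/-- The smooth structure of the orbit, given by the global chart `dualCoords`. -/
instance orbitChartedSpace : ChartedSpace (EuclideanSpace ℝ (Fin 4)) (coadjointOrbit baseDual) :=
  isOpenEmbedding_orbitChart.singletonChartedSpace

/-! ### Smoothness and differentials -/

theorem contMDiff_inclSJ : ContMDiff modelSJ 𝓘(ℝ, ℂ × ℂ) ∞ inclSJ :=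
  ((contMDiff_isOpenEmbedding (I := 𝓘(ℝ, ℂ)) UpperHalfPlane.isOpenEmbedding_coe).comp
    contMDiff_fst).prodMk_space contMDiff_snd

/-- The extended chart of ℍ × ℂ is `inclSJ` itself, so in charts this map is the identity near the
point. Manifold derivatives of J thereby become Fréchet derivatives of `momentumModel`. -/
theorem hasMFDerivAt_inclSJ (p : ℍ × ℂ) :
    HasMFDerivAt modelSJ 𝓘(ℝ, ℂ × ℂ) inclSJ p (ContinuousLinearMap.id ℝ (ℂ × ℂ)) := by
  have hchart : ∀ q, extChartAt modelSJ p q = inclSJ q := fun _ => rfl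
  refine ⟨continuous_inclSJ.continuousAt,
    HasFDerivWithinAt.congr_of_eventuallyEq (hasFDerivAt_id _).hasFDerivWithinAt ?_ ?_⟩
  · filter_upwards [extChartAt_target_mem_nhdsWithin (I := modelSJ) p] with y hy
    exact (hchart _).symm.trans ((extChartAt modelSJ p).right_inv hy)
  · exact congrArg inclSJ (extChartAt_to_inv (I := modelSJ) p)

theorem contMDiff_momentumMap : ContMDiff modelSJ 𝓘(ℝ, JacobiDual) ∞ momentumMap := by
  have h : momentumMap = momentumModel ∘ inclSJ :=
    funext fun p => (momentumModel_inclSJ p).symm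
  rw [h]
  exact contDiffOn_momentumModel.contMDiffOn.comp_contMDiff contMDiff_inclSJ inclSJ_fst_im_pos

theorem hasFDerivAt_momentumModel {w : ℂ × ℂ} (hw : 0 < w.1.im) :
    HasFDerivAt momentumModel (fderiv ℝ momentumModel w) w :=
  ((contDiffOn_momentumModel.contDiffAt (isOpen_halfSpace.mem_nhds hw)).differentiableAt
    (by simp)).hasFDerivAt

theorem hasMFDerivAt_momentumMap (p : ℍ × ℂ) :
    HasMFDerivAt modelSJ 𝓘(ℝ, JacobiDual) momentumMap p
      (fderiv ℝ momentumModel (inclSJ p)) := by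
  have h : momentumMap = momentumModel ∘ inclSJ :=
    funext fun p => (momentumModel_inclSJ p).symm
  rw [h]
  exact (hasFDerivAt_momentumModel (inclSJ_fst_im_pos p)).hasMFDerivAt.comp p
    (hasMFDerivAt_inclSJ p)

theorem fderiv_momentumModel_apply {w : ℂ × ℂ} (hw : 0 < w.1.im) (b : ℂ × ℂ)
    (x : JacobiAlgebra) :
    fderiv ℝ momentumModel w b x = omegaModel w (fundamentalVector x w) b := by
  have hl : HasDerivAt (fun t : ℝ => w + t • b) b 0 := by
    simpa using ((hasDerivAt_id' (0 : ℝ)).smul_const b).const_add w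
  have h0 : w + (0 : ℝ) • b = w := by simp
  have hf : HasFDerivAt momentumModel (fderiv ℝ momentumModel w) (w + (0 : ℝ) • b) := by
    rw [h0]
    exact hasFDerivAt_momentumModel hw
  have h1 : HasDerivAt (fun t : ℝ => momentumModel (w + t • b)) (fderiv ℝ momentumModel w b) 0 :=
    HasFDerivAt.comp_hasDerivAt (f := fun t : ℝ => w + t • b) (l := momentumModel) 0 hf hl
  have h2 := h1.clm_apply (hasDerivAt_const (0 : ℝ) x)
  have h3 := hasDerivAt_psiModel_line x hw b
  -- The line may leave the half-space, so the two functions are compared only for t near 0.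
  have hev : ∀ᶠ t in nhds (0 : ℝ), momentumModel (w + t • b) x = psiModel (w + t • b) x := by
    have : ∀ᶠ t in nhds (0 : ℝ), w + t • b ∈ {w : ℂ × ℂ | 0 < w.1.im} :=
      hl.continuousAt.eventually (isOpen_halfSpace.mem_nhds (by simpa using hw))
    exact this.mono fun t ht => momentumModel_apply ht x
  simpa using h2.unique (h3.congr_of_eventuallyEq hev)

/-! ### The momentum map property, and the differential of J in terms of coadjoint vectors -/

theorem isMomentumMap_momentumMap : IsMomentumMap momentumMap where
  contMDiff := contMDiff_momentumMap
  hamiltonian x p := by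
    refine ⟨_, isFundamentalVector_fundamentalVector x p, fun b => ?_⟩
    have h := (ContinuousLinearMap.apply ℝ ℝ x).hasFDerivAt.hasMFDerivAt.comp p
      (hasMFDerivAt_momentumMap p)
    have h' : mfderiv modelSJ 𝓘(ℝ, ℝ) (fun q => momentumMap q x) p = _ := h.mfderiv
    rw [h']
    refine (omegaKB_eq p _ _).trans ?_
    exact (fderiv_momentumModel_apply (inclSJ_fst_im_pos p) b x).symm

/-- Evaluated at y, the left side is ω(X_y, X_x) = ψ([y, x]); this reversed order is the source of
the sign. -/
theorem fderiv_momentumModel_fundamentalVector (p : ℍ × ℂ) (x : JacobiAlgebra) :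
    fderiv ℝ momentumModel (inclSJ p) (fundamentalVector x (inclSJ p)) =
      coad (-x) (momentumMap p) := by
  ext y
  rw [fderiv_momentumModel_apply (inclSJ_fst_im_pos p),
    omegaModel_fundamentalVector _ _ (inclSJ_fst_im_pos p), coad_apply, momentumMap_apply,
    neg_lie, lie_skew]

theorem fderiv_momentumModel_injective (p : ℍ × ℂ) :
    Function.Injective (fderiv ℝ momentumModel (inclSJ p)) := by
  rw [injective_iff_map_eq_zero]
  intro b hb
  refine eq_zero_of_omegaModel_eq_zero (inclSJ_fst_im_pos p) fun a => ?_
  obtain ⟨x, rfl⟩ := exists_fundamentalVector_eq (inclSJ_fst_im_pos p) a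
  rw [← fderiv_momentumModel_apply (inclSJ_fst_im_pos p), hb]
  rfl

theorem range_fderiv_momentumModel (p : ℍ × ℂ) :
    Set.range (fderiv ℝ momentumModel (inclSJ p)) =
      {u : JacobiDual | ∃ x : JacobiAlgebra, u = coad x (momentumMap p)} := by
  ext u
  constructor
  · rintro ⟨a, rfl⟩
    obtain ⟨x, rfl⟩ := exists_fundamentalVector_eq (inclSJ_fst_im_pos p) a
    exact ⟨-x, fderiv_momentumModel_fundamentalVector p x⟩
  · rintro ⟨x, rfl⟩
    exact ⟨fundamentalVector (-x) (inclSJ p), by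
      rw [fderiv_momentumModel_fundamentalVector, neg_neg]⟩

theorem kks_fderiv_momentumModel (p : ℍ × ℂ) (a b : ℂ × ℂ) :
    kks (momentumMap p) (fderiv ℝ momentumModel (inclSJ p) a)
      (fderiv ℝ momentumModel (inclSJ p) b) = omegaKB p a b := by
  obtain ⟨x, rfl⟩ := exists_fundamentalVector_eq (inclSJ_fst_im_pos p) a
  obtain ⟨y, rfl⟩ := exists_fundamentalVector_eq (inclSJ_fst_im_pos p) b
  rw [fderiv_momentumModel_fundamentalVector, fderiv_momentumModel_fundamentalVector, kks_coad,
    omegaKB_eq, omegaModel_fundamentalVector _ _ (inclSJ_fst_im_pos p), ← momentumMap_apply,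
    neg_lie, lie_neg, neg_neg]

/-! ### The diffeomorphism onto the orbit -/

theorem contMDiff_dualCoords_coe :
    ContMDiff (𝓡 4) (𝓡 4) ∞ fun α : coadjointOrbit baseDual => dualCoords α :=
  contMDiff_isOpenEmbedding (I := 𝓡 4) isOpenEmbedding_orbitChart

theorem contDiff_dualCoords : ContDiff ℝ ∞ dualCoords := by
  rw [contDiff_euclidean]
  intro i
  fin_cases i <;> exact contDiff_id.clm_apply contDiff_const

theorem dualCoords_mem (α : coadjointOrbit baseDual) : dualCoords α ∈ coordsDomain :=
  orbitChart.map_source (Set.mem_univ α)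

theorem momentumMap_pointSJ_dualCoords (α : coadjointOrbit baseDual) :
    momentumMap (pointSJ (dualCoords α)) = α :=
  congrArg Subtype.val (orbitChart.left_inv (Set.mem_univ α))

/-- The momentum map as a diffeomorphism onto the coadjoint orbit. -/
def momentumDiffeomorph : Diffeomorph modelSJ (𝓡 4) (ℍ × ℂ) (coadjointOrbit baseDual) ∞ where
  toFun p := ⟨momentumMap p, momentumMap_mem p⟩
  invFun α := pointSJ (dualCoords α)
  left_inv := pointSJ_dualCoords
  right_inv α := Subtype.ext (momentumMap_pointSJ_dualCoords α)
  -- Smoothness into the orbit is tested in the global chart, which is the restriction of a linear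
  -- map on the dual.
  contMDiff_toFun := ContMDiff.of_comp_isOpenEmbedding (I' := 𝓡 4) isOpenEmbedding_orbitChart
    (contDiff_dualCoords.contMDiff.comp contMDiff_momentumMap)
  contMDiff_invFun := by
    have h : ContMDiff (𝓡 4) 𝓘(ℝ, ℂ × ℂ) ∞
        fun α : coadjointOrbit baseDual => pointOfCoords (dualCoords α) :=
      contDiffOn_pointOfCoords.contMDiffOn.comp_contMDiff contMDiff_dualCoords_coe dualCoords_mem
    have h1 : ContMDiff (𝓡 4) 𝓘(ℝ, ℂ) ∞
        fun α : coadjointOrbit baseDual => ((pointSJ (dualCoords α)).1 : ℂ) :=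
      (contDiff_fst.contMDiff.comp h).congr fun α =>
        congrArg Prod.fst (inclSJ_pointSJ (dualCoords_mem α))
    exact (ContMDiff.of_comp_isOpenEmbedding (I' := 𝓘(ℝ, ℂ)) UpperHalfPlane.isOpenEmbedding_coe
      h1).prodMk (contDiff_snd.contMDiff.comp h)

/-- The inclusion of the orbit is J composed with the inverse diffeomorphism. -/
theorem contMDiff_orbit_coe :
    ContMDiff (𝓡 4) 𝓘(ℝ, JacobiDual) ∞
      (Subtype.val : coadjointOrbit baseDual → JacobiDual) :=
  (contMDiff_momentumMap.comp momentumDiffeomorph.symm.contMDiff).congr fun α =>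
    (momentumMap_pointSJ_dualCoords α).symm

theorem mfderiv_coe_mfderiv_momentumDiffeomorph (p : ℍ × ℂ) (a : TangentSpace modelSJ p) :
    mfderiv (𝓡 4) 𝓘(ℝ, JacobiDual) (Subtype.val : coadjointOrbit baseDual → JacobiDual)
      (momentumDiffeomorph p) (mfderiv modelSJ (𝓡 4) momentumDiffeomorph p a) =
      fderiv ℝ momentumModel (inclSJ p) a := by
  have h := ((contMDiff_orbit_coe.mdifferentiable (by simp)
    (momentumDiffeomorph p)).hasMFDerivAt.comp p
    (momentumDiffeomorph.contMDiff.mdifferentiable (by simp) p).hasMFDerivAt)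
  exact congrArg (fun f : ℂ × ℂ →L[ℝ] JacobiDual => f a)
    (hasMFDerivAt_unique h (hasMFDerivAt_momentumMap p))

theorem mfderiv_momentumDiffeomorph_surjective (p : ℍ × ℂ) :
    Function.Surjective (mfderiv modelSJ (𝓡 4) momentumDiffeomorph p) :=
  (momentumDiffeomorph.mfderivToContinuousLinearEquiv (by simp) p).surjective

/-- Every tangent vector of the orbit is the image of one of ℍ × ℂ under the diffeomorphism, so by
the chain rule injectivity and range of the differential of the inclusion are those of dJ. -/
theorem isOrbitManifold_baseDual : IsOrbitManifold baseDual where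
  isManifold := isOpenEmbedding_orbitChart.isManifold_singleton
  contMDiff_coe := contMDiff_orbit_coe
  injective_mfderiv_coe α := by
    obtain ⟨p, rfl⟩ : ∃ p, momentumDiffeomorph p = α := momentumDiffeomorph.surjective α
    intro u v huv
    obtain ⟨a, rfl⟩ := mfderiv_momentumDiffeomorph_surjective p u
    obtain ⟨b, rfl⟩ := mfderiv_momentumDiffeomorph_surjective p v
    rw [mfderiv_coe_mfderiv_momentumDiffeomorph, mfderiv_coe_mfderiv_momentumDiffeomorph] at huv
    rw [fderiv_momentumModel_injective p huv]
  range_mfderiv_coe α := by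
    obtain ⟨p, rfl⟩ : ∃ p, momentumDiffeomorph p = α := momentumDiffeomorph.surjective α
    rw [← (mfderiv_momentumDiffeomorph_surjective p).range_comp]
    refine Eq.trans (congrArg Set.range (funext fun a => ?_)) (range_fderiv_momentumModel p)
    exact mfderiv_coe_mfderiv_momentumDiffeomorph p a

end SiegelJacobi

end

theorem proposition3p47 :
    SiegelJacobi.IsMomentumMap SiegelJacobi.momentumMap ∧
    ∃ μ : SiegelJacobi.JacobiDual,
      Set.range SiegelJacobi.momentumMap = SiegelJacobi.coadjointOrbit μ ∧
      ∃ _ : ChartedSpace (EuclideanSpace ℝ (Fin 4)) (SiegelJacobi.coadjointOrbit μ),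
        SiegelJacobi.IsOrbitManifold μ ∧
        ∃ Φ : Diffeomorph SiegelJacobi.modelSJ (𝓡 4) (ℍ × ℂ) (SiegelJacobi.coadjointOrbit μ) ∞,
          (∀ p : ℍ × ℂ, (Φ p : SiegelJacobi.JacobiDual) = SiegelJacobi.momentumMap p) ∧
          ∀ (p : ℍ × ℂ) (a b : TangentSpace SiegelJacobi.modelSJ p),
            SiegelJacobi.orbitForm (Φ p)
              (mfderiv SiegelJacobi.modelSJ (𝓡 4) Φ p a)
              (mfderiv SiegelJacobi.modelSJ (𝓡 4) Φ p b) =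
            SiegelJacobi.omegaKB p a b := by
  refine ⟨SiegelJacobi.isMomentumMap_momentumMap, SiegelJacobi.baseDual,
    SiegelJacobi.range_momentumMap, SiegelJacobi.orbitChartedSpace,
    SiegelJacobi.isOrbitManifold_baseDual, SiegelJacobi.momentumDiffeomorph, fun _ => rfl,
    fun p a b => ?_⟩
  rw [SiegelJacobi.orbitForm, SiegelJacobi.mfderiv_coe_mfderiv_momentumDiffeomorph,
    SiegelJacobi.mfderiv_coe_mfderiv_momentumDiffeomorph]
  exact SiegelJacobi.kks_fderiv_momentumModel p a b
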